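/- Let $(R,\mathfrak m,k)$ be a commutative Noetherian local ring of Krull dimension $d$ which is Cohen-Macaulay, i.e. $\operatorname{depth} R = \dim R = d$. Let $M$ be a finitely generated $R$-module (not necessarily maximal Cohen-Macaulay), and let $$\cdots \to F_2 \xrightarrow{\partial_2} F_1 \xrightarrow{\partial_1} F_0 \xrightarrow{\partial_0} M \to 0$$ be an augmented minimal free resolution of $M$, i.e. an exact sequence in which every $F_i$ is a finitely generated free $R$-module and $\partial_{i}(F_{i})\subseteq \mathfrak m F_{i-1}$ for all $i\ge 1$. For $n\ge 0$ let $\Omega_n^R(M)$, the $n$-th syzygy module of $M$, be the image of $\partial_n$ (it is independent of the resolution up to isomorphism). Then for every $n \ge d+1$ no non-zero direct summand $L$ of $\Omega_n^R(M)$ is of any of the following types: 1. $L$ is a semidualizing $R$-module, that is, a finitely generated $R$-module such that the natural homomorphism $R\to \operatorname{Hom}_R(L,L)$ is an isomorphism and $\operatorname{Ext}_R^i(L,L)=0$ for all $i\ge 1$; 2. $L$ is a free $R$-module; 3. $L$ has finite injective dimension over $R$. -/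

import Mathlib

universe u

/-- The depth of a local ring: the supremum of the lengths of the regular sequences contained in
its maximal ideal. -/
noncomputable def localDepth (R : Type u) [CommRing R] [IsLocalRing R] : ℕ∞ :=
  ⨆ (rs : List R) (_ : (∀ r ∈ rs, r ∈ IsLocalRing.maximalIdeal R) ∧
    RingTheory.Sequence.IsRegular R rs), (rs.length : ℕ∞)

/-- A (commutative) local ring is Cohen-Macaulay if it is Noetherian and its depth equals its
Krull dimension. -/
structure IsCohenMacaulayLocalRing (R : Type u) [CommRing R] [IsLocalRing R] : Prop where
  noetherian : IsNoetherianRing R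
  depth_eq_dim : (localDepth R : WithBot ℕ∞) = ringKrullDim R

/-- A minimal free resolution `⋯ → F 2 → F 1 → F 0 → M → 0` of a module `M` over a local ring:
an exact complex of finitely generated free modules, with augmentation `ε : F 0 → M`, such that
the image of each differential `d n : F (n + 1) → F n` lies in `𝔪 • F n`. -/
structure MinimalFreeResolution (R : Type u) [CommRing R] [IsLocalRing R]
    (M : Type u) [AddCommGroup M] [Module R M] where
  F : ℕ → ModuleCat.{u} R
  finite : ∀ n, Module.Finite R (F n)
  free : ∀ n, Module.Free R (F n)
  d : ∀ n, F (n + 1) →ₗ[R] F n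
  ε : F 0 →ₗ[R] M
  ε_surjective : Function.Surjective ε
  exact_zero : Function.Exact (d 0) ε
  exact_succ : ∀ n, Function.Exact (d (n + 1)) (d n)
  minimal : ∀ n, LinearMap.range (d n) ≤
    IsLocalRing.maximalIdeal R • (⊤ : Submodule R (F n))

namespace MinimalFreeResolution

variable {R : Type u} [CommRing R] [IsLocalRing R] {M : Type u} [AddCommGroup M] [Module R M]

/-- The target of the `n`-th differential of the augmented resolution: `M` for `n = 0`, and
`F (n - 1)` for `n ≥ 1`. -/
def augTarget (P : MinimalFreeResolution R M) : ℕ → ModuleCat.{u} R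
  | 0 => ModuleCat.of R M
  | n + 1 => P.F n

/-- The `n`-th differential of the augmented resolution: the augmentation for `n = 0`, and
`F n → F (n - 1)` for `n ≥ 1`. -/
def augDiff (P : MinimalFreeResolution R M) : ∀ n, P.F n →ₗ[R] P.augTarget n
  | 0 => P.ε
  | n + 1 => P.d n

/-- The `n`-th syzygy module: the image of the `n`-th differential of the augmented resolution. -/
def syzygy (P : MinimalFreeResolution R M) (n : ℕ) : Submodule R (P.augTarget n) :=
  LinearMap.range (P.augDiff n)

end MinimalFreeResolution

/-- A finitely generated module `L` is semidualizing if the homothety map `R → End_R(L)` is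
bijective and `Ext^i_R(L, L) = 0` for all `i ≥ 1`. -/
structure IsSemidualizing (R : Type u) [CommRing R] (L : Type u) [AddCommGroup L] [Module R L] :
    Prop where
  finite : Module.Finite R L
  bijective : Function.Bijective (algebraMap R (Module.End R L))
  ext_eq_zero : ∀ i : ℕ, 1 ≤ i →
    Subsingleton (CategoryTheory.Abelian.Ext (ModuleCat.of R L) (ModuleCat.of R L) i)

/-! Choose an `R`-regular sequence `rs` in `𝔪` of length `d`. Since `R ⧸ (rs)` has dimension zero,
it contains a nonzero socle element, the class of some `s`. For `n ≥ d + 1` the reduction `Ω ⧸ rs Ω`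
of the `n`-th syzygy embeds in `F (n - 1) ⧸ rs F (n - 1)`, and by minimality it lands in `𝔪` times
this free module, so `s` kills it (`smul_mem_smul_top_syzygy`). Hence `s` kills `L ⧸ rs L` for each
summand `L`, and `rs` is weakly regular on `L`.

Each of the three types contradicts this. For free `L` it is immediate. For semidualizing `L`, every
map `L → L ⧸ rs L` is a multiple of the projection, whose annihilator is `(rs)`. For `L` of finite
injective dimension, maps to `L ⧸ rs L` extend along `k → R ⧸ (rs)`, `1 ↦ s`; an embedding of `k`
would then send `1` into `s • (L ⧸ rs L) = 0`. -/

open RingTheory.Sequence IsLocalRing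

/-! ### Regular sequences in terms of elements; retracts and free modules. -/

namespace RingTheory.Sequence

lemma isWeaklyRegular_iff_forall_mem {R M : Type*} [CommRing R] [AddCommGroup M] [Module R M]
    (rs : List R) :
    IsWeaklyRegular M rs ↔ ∀ (i : ℕ) (h : i < rs.length) (v : M),
      rs[i] • v ∈ (Ideal.ofList (rs.take i) • ⊤ : Submodule R M) →
        v ∈ (Ideal.ofList (rs.take i) • ⊤ : Submodule R M) := by
  rw [isWeaklyRegular_iff]
  refine forall₂_congr fun i h ↦ ?_
  rw [isSMulRegular_iff_right_eq_zero_of_smul]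
  refine ⟨fun H v hv ↦ ?_, fun H v hv ↦ ?_⟩
  · rw [← Submodule.Quotient.mk_eq_zero]
    apply H
    rwa [← Submodule.Quotient.mk_smul, Submodule.Quotient.mk_eq_zero]
  · obtain ⟨v, rfl⟩ := Submodule.Quotient.mk_surjective _ v
    rw [← Submodule.Quotient.mk_smul, Submodule.Quotient.mk_eq_zero] at hv
    rw [Submodule.Quotient.mk_eq_zero]
    exact H v hv

lemma IsWeaklyRegular.of_flat_module {R : Type*} (M : Type*) [CommRing R] [AddCommGroup M]
    [Module R M] [Module.Flat R M] {rs : List R} (h : IsWeaklyRegular R rs) :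
    IsWeaklyRegular M rs :=
  ((TensorProduct.rid R M).isWeaklyRegular_congr rs).mp (IsWeaklyRegular.isWeaklyRegular_lTensor (M₂ := M) h)

end RingTheory.Sequence

lemma LinearMap.map_mem_smul_top {R M N : Type*} [CommRing R] [AddCommGroup M] [Module R M]
    [AddCommGroup N] [Module R N] (f : M →ₗ[R] N) (I : Ideal R) {v : M}
    (hv : v ∈ (I • ⊤ : Submodule R M)) : f v ∈ (I • ⊤ : Submodule R N) := by
  have := Submodule.mem_map_of_mem (f := f) hv
  rw [Submodule.map_smul''] at this
  exact Submodule.smul_mono le_rfl le_top this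

lemma RingTheory.Sequence.IsWeaklyRegular.of_leftInverse {R M N : Type*} [CommRing R]
    [AddCommGroup M] [Module R M] [AddCommGroup N] [Module R N] {rs : List R}
    (h : IsWeaklyRegular M rs) (i : N →ₗ[R] M) (p : M →ₗ[R] N) (hpi : ∀ v, p (i v) = v) :
    IsWeaklyRegular N rs := by
  rw [isWeaklyRegular_iff_forall_mem] at h ⊢
  intro k hk v hv
  rw [← hpi v]
  refine p.map_mem_smul_top _ (h k hk _ ?_)
  rw [← map_smul]
  exact i.map_mem_smul_top _ hv

lemma Module.Free.mem_of_smul_mem_smul_top {R L : Type*} [CommRing R] [AddCommGroup L]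
    [Module R L] [Module.Free R L] [Nontrivial L] (I : Ideal R) (s : R)
    (h : ∀ v : L, s • v ∈ (I • ⊤ : Submodule R L)) : s ∈ I := by
  let b := Module.Free.chooseBasis R L
  obtain ⟨i⟩ : Nonempty (Module.Free.ChooseBasisIndex R L) := b.index_nonempty
  simpa using (b.coord i).map_mem_smul_top I (h (b i))

/-! ### Reduction of the resolution and its syzygies modulo a regular sequence. -/

namespace MinimalFreeResolution

variable {R : Type u} [CommRing R] [IsLocalRing R] {M : Type u} [AddCommGroup M] [Module R M]

/-- The complex `F ⊗ R ⧸ (r₁, …, rₖ)` is exact in degrees greater than `k`. -/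
lemma mem_smul_top_sup_range (P : MinimalFreeResolution R M) {rs : List R}
    (hrs : IsWeaklyRegular R rs) (k : ℕ) (hk : k ≤ rs.length) (m : ℕ) (hm : k ≤ m)
    (z : P.F (m + 1))
    (hz : P.d m z ∈ (Ideal.ofList (rs.take k) • ⊤ : Submodule R (P.F m))) :
    z ∈ (Ideal.ofList (rs.take k) • ⊤ : Submodule R (P.F (m + 1))) ⊔
      LinearMap.range (P.d (m + 1)) := by
  induction k generalizing m with
  | zero =>
    refine Submodule.mem_sup_right ?_
    rw [List.take_zero, Ideal.ofList_nil, Submodule.bot_smul, Submodule.mem_bot] at hz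
    exact (P.exact_succ m z).mp hz
  | succ k ih =>
    obtain ⟨m, rfl⟩ : ∃ m', m = m' + 1 := ⟨m - 1, by omega⟩
    have hk' : k < rs.length := hk
    have htake : Ideal.ofList (rs.take (k + 1)) =
        Ideal.ofList (rs.take k) ⊔ Ideal.span {rs[k]} := by
      rw [List.take_succ_eq_append_getElem hk', Ideal.ofList_append, Ideal.ofList_singleton]
    have hsmul (n : ℕ) : (Ideal.ofList (rs.take (k + 1)) • ⊤ : Submodule R (P.F n)) =
        Ideal.ofList (rs.take k) • ⊤ ⊔ Ideal.span {rs[k]} • ⊤ := by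
      rw [htake, Submodule.sup_smul]
    have hspan (n : ℕ) (b : P.F n) :
        rs[k] • b ∈ (Ideal.ofList (rs.take (k + 1)) • ⊤ : Submodule R (P.F n)) := by
      rw [hsmul]
      exact Submodule.mem_sup_right (Submodule.smul_mem_smul (Ideal.mem_span_singleton_self _)
        trivial)
    rw [hsmul] at hz
    obtain ⟨a, ha, b', hb', hab⟩ := Submodule.mem_sup.mp hz
    rw [Submodule.ideal_span_singleton_smul] at hb'
    obtain ⟨b, -, rfl⟩ := (Submodule.mem_smul_pointwise_iff_exists _ _ _).mp hb'
    -- Applying the next differential to `∂z = a + rs[k] • b` kills the left side; regularity of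
    -- `rs[k]` modulo the earlier terms then makes `b` a cycle modulo them.
    have hdb : rs[k] • P.d m b ∈ (Ideal.ofList (rs.take k) • ⊤ : Submodule R (P.F m)) := by
      have hdd : P.d m a + rs[k] • P.d m b = 0 := by
        rw [← map_smul, ← map_add, hab]
        exact (P.exact_succ m _).mpr ⟨z, rfl⟩
      rw [eq_neg_of_add_eq_zero_right hdd]
      exact Submodule.neg_mem _ ((P.d m).map_mem_smul_top _ ha)
    have := P.free m
    obtain ⟨b₁, hb₁, b₂, ⟨c, rfl⟩, rfl⟩ := Submodule.mem_sup.mp <| ih (by omega) m (by omega) b <|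
      (isWeaklyRegular_iff_forall_mem rs).mp (hrs.of_flat_module (P.F m)) k hk' _ hdb
    -- With `b = b₁ + ∂c`, subtracting `rs[k] • c` from `z` gives a cycle modulo the first `k`
    -- terms, so induction applies again.
    have hzc : P.d (m + 1) (z - rs[k] • c) ∈
        (Ideal.ofList (rs.take k) • ⊤ : Submodule R (P.F (m + 1))) := by
      have : P.d (m + 1) (z - rs[k] • c) = a + rs[k] • b₁ := by
        rw [map_sub, map_smul, ← hab, smul_add]
        abel
      rw [this]
      exact add_mem ha (Submodule.smul_mem _ _ hb₁)
    have hle : (Ideal.ofList (rs.take k) • ⊤ : Submodule R (P.F (m + 1 + 1))) ⊔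
        LinearMap.range (P.d (m + 1 + 1)) ≤ Ideal.ofList (rs.take (k + 1)) • ⊤ ⊔
        LinearMap.range (P.d (m + 1 + 1)) :=
      sup_le_sup_right (hsmul _ ▸ le_sup_left) _
    simpa using add_mem (hle (ih (by omega) (m + 1) (by omega) _ hzc))
      (Submodule.mem_sup_left (hspan _ c))

/-- This is injectivity of `Ω ⧸ I Ω → F m ⧸ I F m`: a preimage `z` of `v` lies in `I F (m + 1)` up
to a boundary, which does not affect `v`. -/
lemma mem_smul_top_syzygy (P : MinimalFreeResolution R M) {rs : List R}
    (hrs : IsWeaklyRegular R rs) (k : ℕ) (hk : k ≤ rs.length) (m : ℕ) (hm : k ≤ m)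
    (v : LinearMap.range (P.d m))
    (hv : (v : P.F m) ∈ (Ideal.ofList (rs.take k) • ⊤ : Submodule R (P.F m))) :
    v ∈ (Ideal.ofList (rs.take k) • ⊤ : Submodule R (LinearMap.range (P.d m))) := by
  obtain ⟨-, z, rfl⟩ := v
  obtain ⟨a, ha, -, ⟨c, rfl⟩, rfl⟩ :=
    Submodule.mem_sup.mp (P.mem_smul_top_sup_range hrs k hk m hm z hv)
  have hd : P.d m (P.d (m + 1) c) = 0 := (P.exact_succ m _).mpr ⟨c, rfl⟩
  convert! (P.d m).rangeRestrict.map_mem_smul_top _ ha using 1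
  ext
  simp [hd]

lemma isWeaklyRegular_syzygy (P : MinimalFreeResolution R M) {rs : List R}
    (hrs : IsWeaklyRegular R rs) (m : ℕ) (hm : rs.length ≤ m) :
    IsWeaklyRegular (LinearMap.range (P.d m)) rs := by
  rw [isWeaklyRegular_iff_forall_mem]
  intro k hk v hv
  have := P.free m
  refine P.mem_smul_top_syzygy hrs k hk.le m (by omega) v ?_
  exact (isWeaklyRegular_iff_forall_mem rs).mp (hrs.of_flat_module (P.F m)) k hk _
    ((LinearMap.range (P.d m)).subtype.map_mem_smul_top _ hv)

/-- A socle element of `R ⧸ (r₁, …, rₖ)` annihilates `Ω ⧸ (r₁, …, rₖ)Ω` for every syzygy module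
`Ω` of degree greater than `k`. -/
lemma smul_mem_smul_top_syzygy (P : MinimalFreeResolution R M) {rs : List R}
    (hrs : IsWeaklyRegular R rs) (m : ℕ) (hm : rs.length ≤ m) {s : R}
    (hs : ∀ r ∈ maximalIdeal R, r * s ∈ Ideal.ofList rs) (v : LinearMap.range (P.d m)) :
    s • v ∈ (Ideal.ofList rs • ⊤ : Submodule R (LinearMap.range (P.d m))) := by
  have key := P.mem_smul_top_syzygy hrs rs.length le_rfl m hm (s • v)
  rw [List.take_length] at key
  refine key ?_
  refine Submodule.smul_induction_on (p := fun x ↦ s • x ∈ Ideal.ofList rs • ⊤)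
    (P.minimal m v.2) (fun r hr x _ ↦ ?_) fun x y hx hy ↦ ?_
  · rw [smul_smul, mul_comm]
    exact Submodule.smul_mem_smul (hs r hr) trivial
  · rw [smul_add]
    exact add_mem hx hy

end MinimalFreeResolution

/-! ### The zero-dimensional reduction of `R` and its socle. -/

/-- A Cohen-Macaulay local ring has a regular sequence of length equal to its dimension. -/
lemma IsCohenMacaulayLocalRing.exists_isRegular {R : Type u} [CommRing R] [IsLocalRing R]
    (hR : IsCohenMacaulayLocalRing R) (d : ℕ) (hd : ringKrullDim R = d) :
    ∃ rs : List R, (∀ r ∈ rs, r ∈ maximalIdeal R) ∧ IsRegular R rs ∧ rs.length = d := by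
  have hdepth : localDepth R = d := by
    have := hR.depth_eq_dim.trans hd
    exact_mod_cast this
  -- A finite supremum over a nonempty family in `ℕ∞` is attained.
  have : Nonempty {rs : List R // (∀ r ∈ rs, r ∈ maximalIdeal R) ∧ IsRegular R rs} :=
    ⟨[], by simp, IsRegular.nil R R⟩
  rw [localDepth, iSup_subtype'] at hdepth
  obtain ⟨⟨rs, hmem, hreg⟩, hrs⟩ := ENat.exists_eq_iSup_of_lt_top
    (f := fun x : {rs : List R // (∀ r ∈ rs, r ∈ maximalIdeal R) ∧ IsRegular R rs} ↦
      (x.1.length : ℕ∞)) (hdepth ▸ ENat.natCast_lt_top d)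
  exact ⟨rs, hmem, hreg, by exact_mod_cast hrs.trans hdepth⟩

lemma Ideal.eq_maximalIdeal_of_isRegular_of_ofList_le {R : Type u} [CommRing R] [IsLocalRing R]
    [IsNoetherianRing R] {rs : List R} (hrs : IsRegular R rs)
    (hdim : ringKrullDim R = rs.length) {p : Ideal R} (hp : p.IsPrime)
    (hle : Ideal.ofList rs ≤ p) : p = maximalIdeal R := by
  have h := ringKrullDim_add_length_eq_ringKrullDim_of_isRegular rs hrs
  have h0 : ringKrullDim (R ⧸ Ideal.ofList rs) = 0 := by
    rw [hdim] at h
    generalize ringKrullDim (R ⧸ Ideal.ofList rs) = a at h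
    induction a with
    | bot => simp at h
    | coe a =>
      induction a with
      | top => norm_cast at h
      | coe a => norm_cast at h ⊢; omega
  have : Ring.KrullDimLE 0 (R ⧸ Ideal.ofList rs) := Ring.krullDimLE_iff.mpr h0.le
  have := Ideal.map_isPrime_of_surjective (Ideal.Quotient.mk_surjective (I := Ideal.ofList rs))
    (by simpa using hle) (I := p)
  have := this.isMaximal'
  have := Ideal.comap_isMaximal_of_surjective (Ideal.Quotient.mk (Ideal.ofList rs))
    Ideal.Quotient.mk_surjective (K := p.map (Ideal.Quotient.mk (Ideal.ofList rs)))
  rw [Ideal.comap_map_of_surjective _ Ideal.Quotient.mk_surjective,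
    ← RingHom.ker_eq_comap_bot, Ideal.mk_ker, sup_eq_left.mpr hle] at this
  exact IsLocalRing.eq_maximalIdeal this

/-- An associated prime of `N` contains `I`, hence is `𝔪`. -/
lemma exists_injective_residue_linearMap {R N : Type*} [CommRing R] [IsLocalRing R]
    [IsNoetherianRing R] [AddCommGroup N] [Module R N] [Nontrivial N] {I : Ideal R}
    (hI : ∀ p : Ideal R, p.IsPrime → I ≤ p → p = maximalIdeal R)
    (hN : ∀ r ∈ I, ∀ x : N, r • x = 0) :
    ∃ f : (R ⧸ maximalIdeal R) →ₗ[R] N, Function.Injective f := by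
  obtain ⟨p, hp⟩ := associatedPrimes.nonempty R N
  obtain ⟨hp, f, hf⟩ := (_root_.isAssociatedPrime_iff_exists_injective_linearMap p N).mp hp
  obtain rfl : p = maximalIdeal R := hI p hp fun r hr ↦ by
    rw [← Ideal.Quotient.eq_zero_iff_mem]
    apply hf
    rw [map_zero, ← hN r hr (f 1), ← map_smul, Algebra.smul_def, mul_one]
    rfl
  exact ⟨f, hf⟩

lemma nontrivial_quotient_ofList_smul_top {R L : Type*} [CommRing R] [IsLocalRing R]
    [AddCommGroup L] [Module R L] [Module.Finite R L] [Nontrivial L] {I : Ideal R}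
    (hI : I ≤ maximalIdeal R) : Nontrivial (L ⧸ (I • ⊤ : Submodule R L)) := by
  rw [Submodule.Quotient.nontrivial_iff]
  intro h
  exact top_ne_bot (Submodule.eq_bot_of_le_smul_of_le_jacobson_bot I (⊤ : Submodule R L)
    Module.Finite.fg_top h.ge (hI.trans (maximalIdeal_le_jacobson _)))

/-! ### Ext and regular sequences. -/

section

open CategoryTheory Abelian

variable {R : Type u} [CommRing R]

/-- Multiplication by `y` on Ext may be moved to the first argument, where it is zero. -/
lemma ModuleCat.ext_postcomp_smul_eq_zero {A N : ModuleCat.{u} R} {y : R}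
    (hy : ∀ a : A, y • a = 0) {i : ℕ} (x : Ext A N i) :
    x.comp (Ext.mk₀ (N.smulShortComplex y).f) (add_zero i) = 0 := by
  have h0 : y • 𝟙 A = 0 := by
    ext a
    exact hy a
  rw [ModuleCat.smulShortComplex_f_eq_smul_id]
  erw [← Ext.smul_eq_comp_mk₀]
  rw [← Ext.mk₀_id_comp x, ← Ext.smul_comp, ← Ext.mk₀_smul, h0, Ext.mk₀_zero, Ext.zero_comp]
  rfl

/-- `Ext^i(A, N)` vanishes below the length of an `N`-regular sequence annihilating `A`. -/
lemma ModuleCat.subsingleton_ext_of_isWeaklyRegular (A : ModuleCat.{u} R) (rs : List R)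
    (hA : ∀ r ∈ rs, ∀ a : A, r • a = 0) (N : ModuleCat.{u} R) (hN : IsWeaklyRegular N rs)
    (i : ℕ) (hi : i < rs.length) : Subsingleton (Ext A N i) := by
  induction rs generalizing N i with
  | nil => simp at hi
  | cons y rs ih =>
    rw [isWeaklyRegular_cons_iff] at hN
    have hS := hN.1.smulShortComplex_shortExact
    refine subsingleton_of_forall_eq 0 fun x ↦ ?_
    have hx := ModuleCat.ext_postcomp_smul_eq_zero (hA y (by simp)) x
    cases i with
    | zero =>
      have := hS.mono_f
      exact Ext.postcomp_mk₀_injective_of_mono A (N.smulShortComplex y).f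
        (hx.trans (map_zero _).symm)
    | succ i =>
      -- As `y` acts by zero, `x` comes from `Ext^i(A, N ⧸ yN)`, which vanishes by induction.
      obtain ⟨z, rfl⟩ := Ext.covariant_sequence_exact₁ A hS x hx rfl
      have := ih (fun r hr ↦ hA r (by simp [hr])) (ModuleCat.of R (QuotSMulTop y N)) hN.2 i
        (by simpa using hi)
      rw [show z = 0 from Subsingleton.elim (α := Ext A (ModuleCat.of R (QuotSMulTop y N)) i) _ _,
        Ext.zero_comp]
      rfl

/-- If `rs` is an `N`-regular sequence of length `n` annihilating `A` and `B`, extension of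
homomorphisms to `N ⧸ rs N` along `A → B` follows from surjectivity of
`Ext^n(B, N) → Ext^n(A, N)`. -/
lemma ModuleCat.exists_comp_eq_of_ext_surjective {A B : ModuleCat.{u} R} (f : A ⟶ B)
    (rs : List R) (hA : ∀ r ∈ rs, ∀ a : A, r • a = 0) (hB : ∀ r ∈ rs, ∀ b : B, r • b = 0)
    (N : ModuleCat.{u} R) (hN : IsWeaklyRegular N rs)
    (hf : ∀ x : Ext A N rs.length, ∃ z : Ext B N rs.length,
      (Ext.mk₀ f).comp z (zero_add _) = x)
    (φ : A →ₗ[R] N ⧸ (Ideal.ofList rs • ⊤ : Submodule R N)) :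
    ∃ ψ : B →ₗ[R] N ⧸ (Ideal.ofList rs • ⊤ : Submodule R N), ψ ∘ₗ f.hom = φ := by
  induction rs generalizing N with
  | nil =>
    let e : (N ⧸ (Ideal.ofList [] • ⊤ : Submodule R N)) ≃ₗ[R] N :=
      Submodule.quotEquivOfEqBot _
        ((congrArg (· • (⊤ : Submodule R N)) Ideal.ofList_nil).trans (Submodule.bot_smul _))
    obtain ⟨z, hz⟩ := hf (Ext.mk₀ (ModuleCat.ofHom (e.toLinearMap ∘ₗ φ)))
    obtain ⟨ψ, rfl⟩ := Ext.addEquiv₀.symm.surjective z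
    refine ⟨e.symm.toLinearMap ∘ₗ ψ.hom, ?_⟩
    have hψ : f ≫ ψ = ModuleCat.ofHom (e.toLinearMap ∘ₗ φ) := by
      apply Ext.addEquiv₀.symm.injective
      simpa using hz
    have := congr(e.symm.toLinearMap ∘ₗ (ModuleCat.Hom.hom $hψ))
    ext a
    simpa using congr($this a)
  | cons y rs ih =>
    rw [isWeaklyRegular_cons_iff] at hN
    have hS := hN.1.smulShortComplex_shortExact
    have hQ (x : Ext A (N.smulShortComplex y).X₃ rs.length) :
        ∃ z : Ext B (N.smulShortComplex y).X₃ rs.length,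
          (Ext.mk₀ f).comp z (zero_add _) = x := by
      -- Dimension shift: the connecting map to Ext into `N` is surjective for `B` because `y` kills
      -- `B`, and injective for `A` because `Ext(A, N)` vanishes in degree `rs.length`.
      obtain ⟨z, hz⟩ := hf (x.comp hS.extClass rfl)
      obtain ⟨w, rfl⟩ := Ext.covariant_sequence_exact₁ B hS z
        (ModuleCat.ext_postcomp_smul_eq_zero (hB y (by simp)) z) rfl
      refine ⟨w, ?_⟩
      have hδ : (x - (Ext.mk₀ f).comp w (zero_add _)).comp hS.extClass rfl = 0 := by
        rw [sub_eq_add_neg, Ext.add_comp, Ext.neg_comp, ← hz,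
          Ext.comp_assoc _ _ _ (zero_add _) rfl (by simp)]
        exact add_neg_cancel _
      obtain ⟨v, hv⟩ := Ext.covariant_sequence_exact₃ A hS _ rfl hδ
      have := ModuleCat.subsingleton_ext_of_isWeaklyRegular A (y :: rs) hA N
        ((isWeaklyRegular_cons_iff _ _ _).mpr hN) rs.length (by simp)
      rw [show v = 0 from Subsingleton.elim (α := Ext A N rs.length) _ _, Ext.zero_comp] at hv
      exact (sub_eq_zero.mp hv.symm).symm
    let e := Submodule.quotOfListConsSMulTopEquivQuotSMulTopInner N y rs
    obtain ⟨ψ, hψ⟩ := ih (fun r hr ↦ hA r (by simp [hr])) (fun r hr ↦ hB r (by simp [hr]))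
      (ModuleCat.of R (QuotSMulTop y N)) hN.2
      hQ (e.toLinearMap ∘ₗ φ)
    refine ⟨e.symm.toLinearMap ∘ₗ ψ, ?_⟩
    rw [LinearMap.comp_assoc, hψ]
    ext a
    simp

/-- If `Ext^i(L, N) = 0` for `i ≥ 1`, every homomorphism `L → N` is a multiple of `π` and the
annihilator of `π` is contained in `J`, then the annihilator of `L → N → N ⧸ rs N` is contained in
`J + (rs)` for every `N`-regular sequence `rs`. -/
lemma ModuleCat.mem_of_smul_mem_smul_top_of_ext_eq_zero (L : ModuleCat.{u} R) (rs : List R)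
    (N : ModuleCat.{u} R) (hN : IsWeaklyRegular N rs)
    (hext : ∀ i : ℕ, 1 ≤ i → Subsingleton (Ext L N i)) (J : Ideal R) (π : L →ₗ[R] N)
    (hπ : ∀ g : L →ₗ[R] N, ∃ r : R, g = r • π) (hJ : ∀ r : R, r • π = 0 → r ∈ J)
    (s : R) (hs : ∀ v : L, s • π v ∈ (Ideal.ofList rs • ⊤ : Submodule R N)) :
    s ∈ J ⊔ Ideal.ofList rs := by
  induction rs generalizing N J with
  | nil =>
    refine Ideal.mem_sup_left (hJ s ?_)
    ext v
    have := hs v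
    rw [Ideal.ofList_nil, Submodule.bot_smul, Submodule.mem_bot] at this
    exact this
  | cons y rs ih =>
    rw [isWeaklyRegular_cons_iff] at hN
    have hS := hN.1.smulShortComplex_shortExact
    let q : N →ₗ[R] QuotSMulTop y N := Submodule.mkQ _
    rw [Ideal.ofList_cons, ← sup_assoc]
    -- All hypotheses pass to `N ⧸ yN`, with `q ∘ₗ π` for `π` and `J + (y)` for `J`.
    refine ih (ModuleCat.of R (QuotSMulTop y N)) hN.2 (fun i hi ↦ ?_) _ (q ∘ₗ π) (fun g ↦ ?_)
      (fun r hr ↦ ?_) (fun v ↦ ?_)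
    · refine subsingleton_of_forall_eq 0 fun x ↦ ?_
      have := hext (i + 1) (by omega)
      obtain ⟨v, hv⟩ := Ext.covariant_sequence_exact₃ L hS x rfl
        (Subsingleton.elim (α := Ext L N (i + 1)) _ _)
      have := hext i hi
      rw [← hv, show v = 0 from Subsingleton.elim (α := Ext L N i) _ _, Ext.zero_comp]
      rfl
    -- `Ext^1(L, N) = 0` lifts `g` to a map `L → N`.
    · have := hext 1 le_rfl
      obtain ⟨v, hv⟩ := Ext.covariant_sequence_exact₃ L hS
        (Ext.mk₀ (ModuleCat.ofHom g : L ⟶ (N.smulShortComplex y).X₃)) rfl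
        (Subsingleton.elim (α := Ext L N 1) _ _)
      obtain ⟨v, rfl⟩ := Ext.addEquiv₀.symm.surjective v
      obtain ⟨r, hr⟩ := hπ (ModuleCat.Hom.hom v)
      refine ⟨r, ?_⟩
      have hv' : v ≫ (N.smulShortComplex y).g = ModuleCat.ofHom g := by
        apply Ext.addEquiv₀.symm.injective
        simpa using! hv
      rw [← LinearMap.comp_smul, ← hr]
      exact congr(ModuleCat.Hom.hom $hv').symm
    -- If `r • π` has values in `yN`, dividing by `y` gives a map `L → N`, hence some `t • π`, and
    -- `r - t * y` kills `π`.
    · have hr' (v : L) : ∃ w, y • w = r • π v := by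
        have h0 : q (r • π v) = 0 := by
          rw [map_smul]
          exact congr($hr v)
        obtain ⟨w, -, hw⟩ := (Submodule.mem_smul_pointwise_iff_exists _ _ _).mp
          ((Submodule.Quotient.mk_eq_zero _).mp h0)
        exact ⟨w, hw⟩
      choose w hw using hr'
      let g : L →ₗ[R] N :=
        { toFun := w
          map_add' := fun a b ↦ hN.1 (by simp [hw])
          map_smul' := fun c a ↦ hN.1 (by
            simp only [hw, map_smul, RingHom.id_apply]
            rw [smul_comm y c, hw, smul_comm]) }
      obtain ⟨t, ht⟩ := hπ g
      have hrt : r - t * y ∈ J := hJ _ <| by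
        ext v
        have h1 : y • w v = y • t • π v := congr(y • $ht v)
        rw [hw, smul_smul] at h1
        simp [sub_smul, h1, mul_comm t y]
      have := Ideal.add_mem _ (Ideal.mem_sup_left (T := Ideal.span {y}) hrt)
        (Ideal.mem_sup_right (Ideal.mul_mem_left _ t (Ideal.mem_span_singleton_self y)))
      rwa [sub_add_cancel] at this
    · have hv := hs v
      rw [Ideal.ofList_cons_smul] at hv
      obtain ⟨a, ha, b, hb, hab⟩ := Submodule.mem_sup.mp hv
      have hqa : q a = 0 := (Submodule.Quotient.mk_eq_zero _).mpr ha
      change s • q (π v) ∈ (Ideal.ofList rs • ⊤ : Submodule R (QuotSMulTop y N))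
      rw [← map_smul, ← hab, map_add, hqa, zero_add]
      exact q.map_mem_smul_top _ hb

/-- Dévissage: `Ext^i(C, L) = 0` for every finitely generated `C` annihilated by `I`, when the
maximal ideal is the only prime containing `I` and `Ext^i(k, L) = 0`. -/
lemma ModuleCat.subsingleton_ext_of_residue [IsLocalRing R] [IsNoetherianRing R] {I : Ideal R}
    (hI : ∀ p : Ideal R, p.IsPrime → I ≤ p → p = maximalIdeal R) (L : ModuleCat.{u} R) (i : ℕ)
    (hk : Subsingleton (Ext (ModuleCat.of R (R ⧸ maximalIdeal R)) L i))
    (C : Type u) [AddCommGroup C] [Module R C] [hfin : Module.Finite R C]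
    (hC : ∀ r ∈ I, ∀ x : C, r • x = 0) : Subsingleton (Ext (ModuleCat.of R C) L i) := by
  revert hC
  induction hfin using IsNoetherianRing.induction_on_isQuotientEquivQuotientPrime R with
  | subsingleton N =>
    intro _
    refine subsingleton_of_forall_eq 0 fun x ↦ ?_
    rw [← Ext.mk₀_id_comp x, (ModuleCat.isZero_of_subsingleton (ModuleCat.of R N)).eq_of_src (𝟙 _) 0,
      Ext.mk₀_zero, Ext.zero_comp]
  | quotient N p e =>
    intro hC
    have hp : p.1 = maximalIdeal R := hI _ p.2 fun r hr ↦ by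
      rw [← Ideal.Quotient.eq_zero_iff_mem]
      have := congrArg e (hC r hr (e.symm 1))
      rw [map_smul, e.apply_symm_apply, map_zero, Algebra.smul_def, mul_one] at this
      exact this
    let e' : ModuleCat.of R N ≅ ModuleCat.of R (R ⧸ maximalIdeal R) :=
      (e.trans (Submodule.quotEquivOfEq _ _ hp)).toModuleIso
    refine subsingleton_of_forall_eq 0 fun x ↦ ?_
    rw [← Ext.mk₀_id_comp x, ← e'.hom_inv_id, ← Ext.mk₀_comp_mk₀,
      Ext.comp_assoc_of_second_deg_zero, Subsingleton.elim ((Ext.mk₀ e'.inv).comp x _) 0,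
      Ext.comp_zero]
  | exact N₁ N₂ N₃ f g hf hg hfg h₁ h₃ =>
    intro hC
    have h₁ := h₁ fun r hr x ↦ hf (by rw [map_smul, hC r hr, map_zero])
    have h₃ := h₃ fun r hr x ↦ by
      obtain ⟨x, rfl⟩ := hg x
      rw [← map_smul, hC r hr, map_zero]
    have hS := ModuleCat.shortComplex_shortExact
      (ModuleCat.shortComplexOfCompEqZero f g hfg.linearMap_comp_eq_zero) hfg hf hg
    refine subsingleton_of_forall_eq 0 fun x ↦ ?_
    obtain ⟨v, rfl⟩ := Ext.contravariant_sequence_exact₂ hS L x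
      (Subsingleton.elim (α := Ext (ModuleCat.of R N₁) L i) _ _)
    rw [show v = 0 from Subsingleton.elim (α := Ext (ModuleCat.of R N₃) L i) _ _, Ext.comp_zero]

/-- One nonzero test module `B` controls all `C`. By descending induction from degree `t`, embed the
residue field in `B`: vanishing of `Ext^i(B, L)` and of `Ext^(i+1)` of the cokernel forces `Ext^i(k,
L) = 0`, and dévissage gives the rest. -/
lemma ModuleCat.subsingleton_ext_of_hasInjectiveDimensionLT [IsLocalRing R] [IsNoetherianRing R]
    {I : Ideal R} (hI : ∀ p : Ideal R, p.IsPrime → I ≤ p → p = maximalIdeal R)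
    (L : ModuleCat.{u} R) (t : ℕ) [HasInjectiveDimensionLT L t]
    (B : Type u) [AddCommGroup B] [Module R B] [Module.Finite R B] [Nontrivial B]
    (hB : ∀ r ∈ I, ∀ x : B, r • x = 0) (k : ℕ)
    (hk : ∀ i, k ≤ i → Subsingleton (Ext (ModuleCat.of R B) L i)) (i : ℕ) (hi : k ≤ i)
    (C : Type u) [AddCommGroup C] [Module R C] [Module.Finite R C]
    (hC : ∀ r ∈ I, ∀ x : C, r • x = 0) : Subsingleton (Ext (ModuleCat.of R C) L i) := by
  obtain ⟨f, hf⟩ := exists_injective_residue_linearMap hI hB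
  suffices ∀ (j i : ℕ), k ≤ i → t ≤ i + j → ∀ (C : Type u) [AddCommGroup C] [Module R C]
      [Module.Finite R C], (∀ r ∈ I, ∀ x : C, r • x = 0) →
        Subsingleton (Ext (ModuleCat.of R C) L i) from this t i hi (by omega) C hC
  intro j
  induction j with
  | zero => exact fun i _ ht C _ _ _ _ ↦ HasInjectiveDimensionLT.subsingleton L t i ht _
  | succ j ih =>
    intro i hi ht C _ _ _ hC
    refine ModuleCat.subsingleton_ext_of_residue hI L i ?_ C hC
    have hQ := ih (i + 1) (by omega) (by omega) (B ⧸ LinearMap.range f) fun r hr x ↦ by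
      obtain ⟨x, rfl⟩ := Submodule.Quotient.mk_surjective _ x
      rw [← Submodule.Quotient.mk_smul, hB r hr, Submodule.Quotient.mk_zero]
    have hfg := LinearMap.exact_map_mkQ_range f
    have hS := ModuleCat.shortComplex_shortExact
      (ModuleCat.shortComplexOfCompEqZero f _ hfg.linearMap_comp_eq_zero) hfg hf
      (Submodule.mkQ_surjective _)
    have := hk i hi
    refine subsingleton_of_forall_eq 0 fun x ↦ ?_
    obtain ⟨v, rfl⟩ := Ext.contravariant_sequence_exact₁ hS L x (add_comm 1 i)
      (Subsingleton.elim (α := Ext (ModuleCat.of R (B ⧸ LinearMap.range f)) L (i + 1)) _ _)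
    rw [show v = 0 from Subsingleton.elim (α := Ext (ModuleCat.of R B) L i) _ _, Ext.comp_zero]

end

/-! ### Faithfulness of `L ⧸ rs L` in the semidualizing and finite injective dimension cases. -/

section

open CategoryTheory Abelian

variable {R : Type u} [CommRing R]

lemma IsSemidualizing.mem_of_smul_mem_smul_top {L : Type u} [AddCommGroup L] [Module R L]
    (hL : IsSemidualizing R L) {rs : List R} (hrs : IsWeaklyRegular L rs) {s : R}
    (hs : ∀ v : L, s • v ∈ (Ideal.ofList rs • ⊤ : Submodule R L)) : s ∈ Ideal.ofList rs := by
  have := ModuleCat.mem_of_smul_mem_smul_top_of_ext_eq_zero (ModuleCat.of R L) rs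
    (ModuleCat.of R L) hrs hL.ext_eq_zero ⊥ LinearMap.id (fun g ↦ ?_) (fun r hr ↦ ?_) s hs
  · simpa using this
  · obtain ⟨r, rfl⟩ := hL.bijective.2 g
    exact ⟨r, rfl⟩
  · exact hL.bijective.1 (hr.trans (map_zero _).symm)

variable [IsLocalRing R] [IsNoetherianRing R]

lemma ModuleCat.subsingleton_ext_quotient_of_isRegular {rs : List R} (hrs : IsRegular R rs)
    (hmem : ∀ r ∈ rs, r ∈ maximalIdeal R) (L : ModuleCat.{u} R) (i : ℕ) (hi : rs.length + 1 ≤ i) :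
    Subsingleton (Ext (ModuleCat.of R (R ⧸ (Ideal.ofList rs • ⊤ : Submodule R R))) L i) := by
  have h := ModuleCat.projectiveDimension_quotient_eq_add_length_of_isWeaklyRegular
    (ModuleCat.of R R) rs hrs.1 hmem
  rw [ModuleCat.projectiveDimension_eq_zero_of_projective (ModuleCat.of R R),
    zero_add] at h
  have : HasProjectiveDimensionLT
      (ModuleCat.of R (R ⧸ (Ideal.ofList rs • ⊤ : Submodule R R))) (rs.length + 1) :=
    (projectiveDimension_le_iff _ rs.length).mp h.le
  exact HasProjectiveDimensionLT.subsingleton _ (rs.length + 1) i hi L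

/-- A module of finite injective dimension which is maximal Cohen-Macaulay has faithful reductions
modulo maximal regular sequences. -/
lemma exists_smul_notMem_smul_top_of_injectiveDimension {rs : List R} (hrs : IsRegular R rs)
    (hdim : ringKrullDim R = rs.length) (hmem : ∀ r ∈ rs, r ∈ maximalIdeal R)
    {L : Type u} [AddCommGroup L] [Module R L] [Module.Finite R L] [Nontrivial L]
    (hL : IsWeaklyRegular L rs) (hid : injectiveDimension (ModuleCat.of R L) < ⊤) (s : R)
    (hs : s ∉ Ideal.ofList rs) (hsocle : ∀ r ∈ maximalIdeal R, r * s ∈ Ideal.ofList rs) :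
    ∃ v : L, s • v ∉ (Ideal.ofList rs • ⊤ : Submodule R L) := by
  by_contra! hsL
  set I := Ideal.ofList rs
  have hprime (p : Ideal R) (hp : p.IsPrime) (hle : I ≤ p) : p = maximalIdeal R :=
    Ideal.eq_maximalIdeal_of_isRegular_of_ofList_le hrs hdim hp hle
  have hIm : I ≤ maximalIdeal R := Ideal.span_le.mpr hmem
  have hquot (N : Type u) [AddCommGroup N] [Module R N] (r : R) (hr : r ∈ I)
      (x : N ⧸ (I • ⊤ : Submodule R N)) : r • x = 0 := by
    obtain ⟨x, rfl⟩ := Submodule.Quotient.mk_surjective _ x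
    rw [← Submodule.Quotient.mk_smul, Submodule.Quotient.mk_eq_zero]
    exact Submodule.smul_mem_smul hr trivial
  have := nontrivial_quotient_ofList_smul_top (L := L) hIm
  have := nontrivial_quotient_ofList_smul_top (L := R) hIm
  obtain ⟨φ, hφ⟩ := exists_injective_residue_linearMap hprime (hquot L)
  let f : (R ⧸ maximalIdeal R) →ₗ[R] R ⧸ (I • ⊤ : Submodule R R) :=
    Submodule.liftQ _ (LinearMap.toSpanSingleton R _ (Submodule.Quotient.mk s)) fun r hr ↦ by
      rw [LinearMap.mem_ker, LinearMap.toSpanSingleton_apply, ← Submodule.Quotient.mk_smul,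
        Submodule.Quotient.mk_eq_zero]
      simpa using hsocle r hr
  have hf1 : f 1 = Submodule.Quotient.mk s :=
    (Submodule.liftQ_apply _ _ (1 : R)).trans (one_smul R _)
  have hf : Function.Injective f := by
    rw [injective_iff_map_eq_zero]
    intro x hx
    obtain ⟨r, rfl⟩ := Ideal.Quotient.mk_surjective x
    rw [Ideal.Quotient.eq_zero_iff_mem]
    by_contra hr
    have hrs : r • s ∈ (I • ⊤ : Submodule R R) := (Submodule.Quotient.mk_eq_zero _).mp hx
    rw [smul_eq_mul, Ideal.mul_top] at hrs
    exact hs ((Ideal.unit_mul_mem_iff_mem I (IsLocalRing.notMem_maximalIdeal.mp hr)).mp hrs)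
  obtain ⟨t, ht⟩ := (injectiveDimension_ne_top_iff _).mp hid.ne
  -- The bound `rs.length + 1` comes from the projective dimension of `R ⧸ (rs)`. Vanishing on the
  -- cokernel of `f` makes `Ext^d(R ⧸ (rs), L) → Ext^d(k, L)` surjective, where `d = rs.length`.
  have hvanish := ModuleCat.subsingleton_ext_of_hasInjectiveDimensionLT hprime
    (ModuleCat.of R L) (t + 1) (R ⧸ (I • ⊤ : Submodule R R)) (hquot R) (rs.length + 1)
    (ModuleCat.subsingleton_ext_quotient_of_isRegular hrs hmem _) (rs.length + 1) le_rfl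
    ((R ⧸ (I • ⊤ : Submodule R R)) ⧸ LinearMap.range f) fun r hr x ↦ by
      obtain ⟨x, rfl⟩ := Submodule.Quotient.mk_surjective _ x
      rw [← Submodule.Quotient.mk_smul, hquot R r hr, Submodule.Quotient.mk_zero]
  have hfg := LinearMap.exact_map_mkQ_range f
  have hS := ModuleCat.shortComplex_shortExact
    (ModuleCat.shortComplexOfCompEqZero f _ hfg.linearMap_comp_eq_zero) hfg hf
    (Submodule.mkQ_surjective _)
  have hle : ∀ r ∈ rs, r ∈ I := fun r hr ↦ Ideal.subset_span hr
  obtain ⟨ψ, hψ⟩ := ModuleCat.exists_comp_eq_of_ext_surjective (ModuleCat.ofHom f) rs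
    (fun r hr a ↦ hφ (by rw [map_smul, hquot L r (hle r hr), map_zero]))
    (fun r hr ↦ hquot R r (hle r hr)) (ModuleCat.of R L) hL
    (fun x ↦ Ext.contravariant_sequence_exact₁ hS _ x (add_comm 1 _)
      (hvanish.elim _ _)) φ
  -- `φ 1 = ψ s = s • ψ 1`, and `s` kills `L ⧸ rs L`.
  have h1 : φ 1 = 0 := by
    rw [← hψ]
    change ψ (f 1) = 0
    obtain ⟨v, hv⟩ := Submodule.Quotient.mk_surjective _ (ψ (Submodule.Quotient.mk 1))
    rw [hf1, ← mul_one s, ← smul_eq_mul, Submodule.Quotient.mk_smul, map_smul, ← hv,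
      ← Submodule.Quotient.mk_smul]
    exact (Submodule.Quotient.mk_eq_zero _).mpr (hsL v)
  exact one_ne_zero (hφ (h1.trans (map_zero φ).symm))

end

/-! ### Conclusion. -/

theorem corollary3p4 {R : Type u} [CommRing R] [IsLocalRing R]
    (hR : IsCohenMacaulayLocalRing R) (d : ℕ) (hd : ringKrullDim R = d)
    {M : Type u} [AddCommGroup M] [Module R M] [Module.Finite R M]
    (P : MinimalFreeResolution R M) (n : ℕ) (hn : d + 1 ≤ n)
    {L K : Type u} [AddCommGroup L] [Module R L] [AddCommGroup K] [Module R K]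
    (e : P.syzygy n ≃ₗ[R] L × K) (hL : Nontrivial L) :
    ¬ IsSemidualizing R L ∧
      ¬ Module.Free R L ∧
      ¬ CategoryTheory.injectiveDimension (ModuleCat.of R L) < ⊤ := by
  have := hR.noetherian
  -- The `(m + 1)`-st syzygy is the range of `P.d m` in `P.F m`, so `n ≥ d + 1` becomes `m ≥ d`, the
  -- bound needed for exactness modulo `rs`.
  obtain ⟨m, rfl⟩ : ∃ m, n = m + 1 := ⟨n - 1, by omega⟩
  obtain ⟨rs, hmem, hreg, rfl⟩ := hR.exists_isRegular d hd
  change LinearMap.range (P.d m) ≃ₗ[R] L × K at e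
  have hm : rs.length ≤ m := by omega
  let i : L →ₗ[R] LinearMap.range (P.d m) := e.symm.toLinearMap ∘ₗ LinearMap.inl R L K
  let p : LinearMap.range (P.d m) →ₗ[R] L := LinearMap.fst R L K ∘ₗ e.toLinearMap
  have hpi (v : L) : p (i v) = v := by simp [p, i]
  have hLreg : IsWeaklyRegular L rs := (P.isWeaklyRegular_syzygy hreg.1 m hm).of_leftInverse i p hpi
  have hLfin : Module.Finite R L := by
    have := P.finite (m + 1)
    exact Module.Finite.of_surjective p fun v ↦ ⟨i v, hpi v⟩
  have hIm : Ideal.ofList rs ≤ maximalIdeal R := Ideal.span_le.mpr hmem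
  -- `s` lifts the image of `1` under an embedding of the residue field in `R ⧸ (rs)`.
  obtain ⟨s, hs, hsocle⟩ : ∃ s : R, s ∉ Ideal.ofList rs ∧
      ∀ r ∈ maximalIdeal R, r * s ∈ Ideal.ofList rs := by
    have : Nontrivial (R ⧸ Ideal.ofList rs) :=
      Ideal.Quotient.nontrivial_iff.mpr (hIm.trans_lt (lt_top_iff_ne_top.mpr
        (Ideal.IsPrime.ne_top'))).ne
    obtain ⟨f, hf⟩ := exists_injective_residue_linearMap (N := R ⧸ Ideal.ofList rs)
      (fun p hp hle ↦ Ideal.eq_maximalIdeal_of_isRegular_of_ofList_le hreg hd hp hle)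
      fun r hr x ↦ by
        rw [Algebra.smul_def]
        exact (congrArg (· * x) (Ideal.Quotient.eq_zero_iff_mem.mpr hr)).trans (zero_mul x)
    obtain ⟨s, hs⟩ := Ideal.Quotient.mk_surjective (f 1)
    refine ⟨s, fun h ↦ ?_, fun r hr ↦ ?_⟩
    · rw [Ideal.Quotient.eq_zero_iff_mem.mpr h] at hs
      exact one_ne_zero (hf (hs.symm.trans (map_zero f).symm))
    · rw [← Ideal.Quotient.eq_zero_iff_mem, map_mul, hs]
      have h0 : r • (1 : R ⧸ maximalIdeal R) = 0 := by
        rw [Algebra.smul_def, mul_one]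
        exact Ideal.Quotient.eq_zero_iff_mem.mpr hr
      have := congrArg f h0
      rwa [map_smul, map_zero, Algebra.smul_def] at this
  have hsL (v : L) : s • v ∈ (Ideal.ofList rs • ⊤ : Submodule R L) := by
    have := p.map_mem_smul_top _ (P.smul_mem_smul_top_syzygy hreg.1 m hm hsocle (i v))
    rwa [map_smul, hpi] at this
  refine ⟨fun h ↦ hs (h.mem_of_smul_mem_smul_top hLreg hsL),
    fun h ↦ hs (Module.Free.mem_of_smul_mem_smul_top _ s hsL), fun h ↦ ?_⟩
  obtain ⟨v, hv⟩ := exists_smul_notMem_smul_top_of_injectiveDimension hreg hd hmem hLreg h s hs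
    hsocle
  exact hv (hsL v)
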